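/- Let $d\ge 1$, let $\Omega\subset\mathbb{R}^d$ be a bounded domain (nonempty connected open set), let $\varepsilon>0$, and let $\phi$ be either the MultiQuadric $\phi(r)=\sqrt{1+(\varepsilon r)^2}$ or the Inverse MultiQuadric $\phi(r)=1/\sqrt{1+(\varepsilon r)^2}$. For a point $A\in\mathbb{R}^d$ put $\phi_A(x)=\phi(\|x-A\|_2)$. Given points $P_1,\dots,P_n\in\Omega$ and $Q_1,\dots,Q_m\in\partial\Omega$, the unsymmetric Kansa collocation matrix of the Dirichlet problem for the Poisson equation ($\Delta u=f$ in $\Omega$, $u=g$ on $\partial\Omega$) is the $(n+m)\times(n+m)$ block matrix $$K_{n,m}=\begin{pmatrix} \big(\Delta\phi_{P_j}(P_i)\big)_{i,j} & \big(\Delta\phi_{Q_k}(P_i)\big)_{i,k}\\ \big(\phi_{P_j}(Q_h)\big)_{h,j} & \big(\phi_{Q_k}(Q_h)\big)_{h,k}\end{pmatrix},\qquad 1\le i,j\le n,\ 1\le h,k\le m,$$ where $\Delta$ is the Laplacian on $\mathbb{R}^d$. Let $m\ge 1$, let $Q_1,\dots,Q_m$ be any fixed distinct points of $\partial\Omega$,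 let $\sigma\in L^1(\Omega)$ be any probability density (that is, $\sigma\ge 0$ almost everywhere on $\Omega$ and $\int_\Omega\sigma\,dx=1$), let $n\ge 0$, and let $P_1,\dots,P_n$ be independent random points of $\Omega$, each distributed with density $\sigma$ with respect to Lebesgue measure. Then $K_{n,m}$ is almost surely nonsingular, i.e. $\det K_{n,m}\neq 0$ with probability one. -/

import Mathlib

open MeasureTheory ProbabilityTheory

noncomputable section

namespace Kansa

/-- The MultiQuadric radial profile with shape parameter `ε`. -/
def multiquadric (ε r : ℝ) : ℝ := Real.sqrt (1 + (ε * r) ^ 2)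

/-- The Inverse MultiQuadric radial profile with shape parameter `ε`. -/
def inverseMultiquadric (ε r : ℝ) : ℝ := 1 / Real.sqrt (1 + (ε * r) ^ 2)

/-- The radial basis function with profile `φ` centered at `A`, for the Euclidean norm. -/
def basisFun {d : ℕ} (φ : ℝ → ℝ) (A : EuclideanSpace ℝ (Fin d)) :
    EuclideanSpace ℝ (Fin d) → ℝ :=
  fun x => φ ‖x - A‖

/-- The unsymmetric Kansa collocation matrix of the Dirichlet problem of the Poisson equation,
with interior points `P` and boundary points `Q`. The rows are the collocation conditions (the
Laplacian at the `P i`, then the value at the `Q h`) and the columns are the basis functions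
(centered at the `P j`, then at the `Q k`). -/
def kansaMatrix {d n m : ℕ} (φ : ℝ → ℝ) (P : Fin n → EuclideanSpace ℝ (Fin d))
    (Q : Fin m → EuclideanSpace ℝ (Fin d)) : Matrix (Fin n ⊕ Fin m) (Fin n ⊕ Fin m) ℝ :=
  Matrix.fromBlocks
    (Matrix.of fun i j => Laplacian.laplacian (basisFun φ (P j)) (P i))
    (Matrix.of fun i k => Laplacian.laplacian (basisFun φ (Q k)) (P i))
    (Matrix.of fun h j => basisFun φ (P j) (Q h))
    (Matrix.of fun h k => basisFun φ (Q k) (Q h))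

/-- `σ` is a probability density on `D` with respect to Lebesgue measure: integrable on `D`,
nonnegative almost everywhere on `D`, with integral one over `D`. -/
structure IsProbDensityOn {d : ℕ} (σ : EuclideanSpace ℝ (Fin d) → ℝ)
    (D : Set (EuclideanSpace ℝ (Fin d))) : Prop where
  integrableOn : IntegrableOn σ D volume
  nonneg : ∀ᵐ x ∂(volume.restrict D), 0 ≤ σ x
  integral_eq_one : ∫ x in D, σ x = 1

/-- The measure with density `σ` on `D`, and no mass outside `D`. -/
def densityMeasure {d : ℕ} (σ : EuclideanSpace ℝ (Fin d) → ℝ)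
    (D : Set (EuclideanSpace ℝ (Fin d))) : Measure (EuclideanSpace ℝ (Fin d)) :=
  (volume.restrict D).withDensity fun x => ENNReal.ofReal (σ x)

end Kansa

end

namespace Kansa

open Filter Topology

/-! ### Strict definiteness of the two kernels, and nonsingular interpolation matrices. -/

section Interpolation

variable {ι : Type*} [Fintype ι] {E : Type*} [NormedAddCommGroup E] [InnerProductSpace ℝ E]
  [FiniteDimensional ℝ E]

/-! The proof is an induction on the number of random points. With none, the matrix is the
interpolation matrix at the `Q h`, nonsingular by the classical definiteness of the two kernels
(`interpolation_det_ne_zero`).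

For the inductive step, fix points with nonsingular matrix `K` and add a point `x`. The new
determinant is real-analytic in `x`, so its zero set is null unless it vanishes identically, and
Fubini concludes. By the Schur complement (`kansaMatrix_cons_det`), vanishing identically would make
a bilinear expression in the Laplacians and values at `x`, with coefficients from `K⁻¹`, equal
everywhere to the Laplacian of a basis function at its own center, which is a nonzero constant.

This is refuted by complex continuation (`eq_zero_of_sum_sqrtProfile_eq`). With `q = 1 + ε²‖x -
A‖²`, every function involved is `√q` times a rational function of `q`. On a line through the origin
in a generic direction, the `q`'s become real quadratics with a common leading coefficient, distinct
vertices and no real root. Continue from the real line to a root of one of them, where the other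
square roots stay analytic: terms containing that square root only once must cancel among
themselves, by parity of vanishing orders (`sum_sqrtTerm_drop`). The remaining diagonal terms are
rational, each with a pole that no other term can cancel, so their coefficients are zero and so is
the constant (`eq_zero_of_sum_sqrtTerm_eq`). -/

lemma exp_neg_sq_norm_eq_integral_cos [MeasurableSpace E] [BorelSpace E] (v : E) :
    Real.exp (-‖v‖ ^ 2 / 2) = ∫ z, Real.cos (inner ℝ z v) ∂(stdGaussian E) := by
  have h := charFun_stdGaussian (E := E) v
  rw [charFun_apply] at h
  have hint : Integrable (fun z : E => Complex.exp (inner ℝ z v * Complex.I)) (stdGaussian E) := by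
    refine Integrable.of_bound (by fun_prop) 1 (ae_of_all _ fun z => ?_)
    rw [Complex.norm_exp_ofReal_mul_I]
  have h2 := congrArg Complex.re h
  rw [← RCLike.re_eq_complex_re, ← integral_re hint, RCLike.re_eq_complex_re] at h2
  simp only [Complex.exp_ofReal_mul_I_re] at h2
  rw [h2, ← Complex.exp_ofReal_re]
  push_cast
  rfl

/-- The Gaussian kernel is positive semidefinite. -/
lemma gaussian_quadForm_nonneg (x : ι → E) (c : ι → ℝ) {t : ℝ} (ht : 0 ≤ t) :
    0 ≤ ∑ i, ∑ j, c i * c j * Real.exp (-(t * ‖x i - x j‖ ^ 2)) := by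
  borelize E
  set y : ι → E := fun i => Real.sqrt (2 * t) • x i with hy
  have hexp : ∀ i j, Real.exp (-(t * ‖x i - x j‖ ^ 2)) =
      ∫ z, Real.cos (inner ℝ z (y i - y j)) ∂(stdGaussian E) := by
    intro i j
    rw [← exp_neg_sq_norm_eq_integral_cos, hy]
    simp only [← smul_sub, norm_smul, Real.norm_eq_abs, mul_pow, sq_abs]
    rw [Real.sq_sqrt (by positivity)]
    congr 1
    ring
  have hint : ∀ i j, Integrable (fun z : E => c i * c j * Real.cos (inner ℝ z (y i - y j)))
      (stdGaussian E) := fun i j =>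
    (Integrable.of_bound (by fun_prop) 1
      (ae_of_all _ fun z => by simpa using Real.abs_cos_le_one _)).const_mul _
  simp_rw [hexp, ← integral_const_mul]
  have h1 : ∀ i, ∑ j, ∫ z, c i * c j * Real.cos (inner ℝ z (y i - y j)) ∂(stdGaussian E) =
      ∫ z, ∑ j, c i * c j * Real.cos (inner ℝ z (y i - y j)) ∂(stdGaussian E) := fun i =>
    (integral_finsetSum _ fun j _ => hint i j).symm
  simp_rw [h1]
  rw [← integral_finsetSum _ fun i _ => integrable_finsetSum _ fun j _ => hint i j]
  refine integral_nonneg fun z => ?_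
  have : ∑ i, ∑ j, c i * c j * Real.cos (inner ℝ z (y i - y j)) =
      (∑ i, c i * Real.cos (inner ℝ z (y i))) ^ 2 +
      (∑ i, c i * Real.sin (inner ℝ z (y i))) ^ 2 := by
    rw [sq, sq, Finset.sum_mul_sum, Finset.sum_mul_sum, ← Finset.sum_add_distrib]
    refine Finset.sum_congr rfl fun i _ => ?_
    rw [← Finset.sum_add_distrib]
    refine Finset.sum_congr rfl fun j _ => ?_
    rw [inner_sub_right, Real.cos_sub]
    ring
  simp only [Pi.zero_apply]
  rw [this]
  positivity

lemma inv_sqrt_eq_integral {b : ℝ} (hb : 0 < b) :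
    (Real.sqrt b)⁻¹ = (Real.sqrt Real.pi)⁻¹ * ∫ u : ℝ, Real.exp (-b * u ^ 2) := by
  rw [integral_gaussian, Real.sqrt_div Real.pi_pos.le]
  have : Real.sqrt Real.pi ≠ 0 := (Real.sqrt_pos.2 Real.pi_pos).ne'
  field_simp

/-- The inverse multiquadric kernel is strictly positive definite. -/
lemma inverseMultiquadric_quadForm_pos {x : ι → E} (hx : Function.Injective x) {c : ι → ℝ}
    (hc : c ≠ 0) {a w : ℝ} (ha : 0 < a) (hw : 0 < w) :
    0 < ∑ i, ∑ j, c i * c j * (Real.sqrt (a + w * ‖x i - x j‖ ^ 2))⁻¹ := by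
  classical
  have hpos : ∀ i j, 0 < a + w * ‖x i - x j‖ ^ 2 := fun i j => by positivity
  have hint : ∀ i j, Integrable fun u : ℝ =>
      c i * c j * Real.exp (-(a + w * ‖x i - x j‖ ^ 2) * u ^ 2) := fun i j =>
    (integrable_exp_neg_mul_sq (hpos i j)).const_mul _
  have hsum : ∑ i, ∑ j, c i * c j * (Real.sqrt (a + w * ‖x i - x j‖ ^ 2))⁻¹ =
      (Real.sqrt Real.pi)⁻¹ * ∫ u : ℝ, ∑ i, ∑ j,
        c i * c j * Real.exp (-(a + w * ‖x i - x j‖ ^ 2) * u ^ 2) := by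
    rw [integral_finsetSum _ fun i _ => integrable_finsetSum _ fun j _ => hint i j,
      Finset.mul_sum]
    refine Finset.sum_congr rfl fun i _ => ?_
    rw [integral_finsetSum _ fun j _ => hint i j, Finset.mul_sum]
    refine Finset.sum_congr rfl fun j _ => ?_
    rw [inv_sqrt_eq_integral (hpos i j), integral_const_mul]
    ring
  have hfac : ∀ u : ℝ, ∑ i, ∑ j, c i * c j * Real.exp (-(a + w * ‖x i - x j‖ ^ 2) * u ^ 2) =
      Real.exp (-(a * u ^ 2)) *
        ∑ i, ∑ j, c i * c j * Real.exp (-((w * u ^ 2) * ‖x i - x j‖ ^ 2)) := by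
    intro u
    simp_rw [Finset.mul_sum]
    refine Finset.sum_congr rfl fun i _ => Finset.sum_congr rfl fun j _ => ?_
    rw [mul_left_comm, ← Real.exp_add]
    congr 2
    ring
  -- Strictness needs only one scale: as `s → ∞` the Gaussian form tends to `∑ c i ^ 2 > 0`.
  have hlim : Tendsto (fun s : ℝ => ∑ i, ∑ j, c i * c j * Real.exp (-(s * ‖x i - x j‖ ^ 2)))
      atTop (𝓝 (∑ i, ∑ j, c i * c j * if i = j then 1 else 0)) := by
    refine tendsto_finsetSum _ fun i _ => tendsto_finsetSum _ fun j _ =>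
      Tendsto.const_mul _ ?_
    split_ifs with hij
    · simp [hij]
    · have : 0 < ‖x i - x j‖ ^ 2 := by
        have := sub_ne_zero.2 (hx.ne hij)
        positivity
      exact Real.tendsto_exp_neg_atTop_nhds_zero.comp (tendsto_id.atTop_mul_const this)
  have hdiag : 0 < ∑ i, ∑ j, c i * c j * if i = j then 1 else 0 := by
    obtain ⟨k, hk⟩ := Function.ne_iff.1 hc
    simp only [mul_ite, mul_one, mul_zero, Finset.sum_ite_eq, Finset.mem_univ, if_true]
    exact Finset.sum_pos' (fun i _ => mul_self_nonneg _) ⟨k, Finset.mem_univ _,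
      mul_self_pos.2 hk⟩
  obtain ⟨s, hs0, hs⟩ := ((eventually_ge_atTop 0).and (hlim.eventually_const_lt hdiag)).exists
  rw [hsum]
  refine mul_pos (inv_pos.2 (Real.sqrt_pos.2 Real.pi_pos)) ?_
  -- At `u = √(s / w)` the Gaussian scale `w * u ^ 2` is the `s` just found; continuity of the
  -- nonnegative integrand does the rest.
  refine integral_pos_of_integrable_nonneg_nonzero (x := Real.sqrt (s / w)) (by fun_prop)
    (integrable_finsetSum _ fun i _ => integrable_finsetSum _ fun j _ => hint i j) ?_ ?_
  · intro u
    simp only [Pi.zero_apply]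
    rw [hfac]
    exact mul_nonneg (Real.exp_nonneg _) (gaussian_quadForm_nonneg x c (by positivity))
  · rw [hfac, Real.sq_sqrt (by positivity), mul_div_cancel₀ _ hw.ne']
    exact (mul_pos (Real.exp_pos _) hs).ne'

lemma tendsto_sqrt_add_sub_sqrt {b : ℝ} (hb : 0 ≤ b) :
    Tendsto (fun t : ℝ => Real.sqrt (t + b) - Real.sqrt t) atTop (𝓝 0) := by
  have h : Tendsto (fun t : ℝ => b / Real.sqrt t) atTop (𝓝 0) :=
    Tendsto.const_div_atTop Real.tendsto_sqrt_atTop b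
  refine tendsto_of_tendsto_of_tendsto_of_le_of_le' tendsto_const_nhds h ?_ ?_
  · exact Eventually.of_forall fun t => sub_nonneg.2 (Real.sqrt_le_sqrt (by linarith))
  · filter_upwards [eventually_gt_atTop 0] with t ht
    have h1 : 0 < Real.sqrt t := Real.sqrt_pos.2 ht
    have h2 : Real.sqrt t ≤ Real.sqrt (t + b) := Real.sqrt_le_sqrt (by linarith)
    have h3 := Real.sq_sqrt ht.le
    have h4 := Real.sq_sqrt (show 0 ≤ t + b by linarith)
    rw [le_div_iff₀ h1]
    nlinarith

/-- The multiquadric kernel is strictly conditionally negative definite of order one. -/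
lemma multiquadric_quadForm_neg {x : ι → E} (hx : Function.Injective x) {c : ι → ℝ}
    (hc : c ≠ 0) (hsum : ∑ i, c i = 0) {w : ℝ} (hw : 0 < w) :
    ∑ i, ∑ j, c i * c j * Real.sqrt (1 + w * ‖x i - x j‖ ^ 2) < 0 := by
  -- With the constant 1 freed to `a`, the derivative of `F` is half an inverse multiquadric form.
  -- So `F` increases strictly, and its limit at infinity is 0 because the coefficients sum to zero;
  -- hence `F 1 < 0`.
  set F : ℝ → ℝ := fun a => ∑ i, ∑ j, c i * c j * Real.sqrt (a + w * ‖x i - x j‖ ^ 2) with hF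
  have hder : ∀ a, 0 < a → HasDerivAt F
      (∑ i, ∑ j, c i * c j * (1 / (2 * Real.sqrt (a + w * ‖x i - x j‖ ^ 2)))) a := by
    intro a ha
    refine HasDerivAt.fun_sum fun i _ => HasDerivAt.fun_sum fun j _ => ?_
    exact (((hasDerivAt_id a).add_const _).sqrt (by simp only [id]; positivity)).const_mul _
  have hder_pos : ∀ a, 0 < a → 0 < deriv F a := by
    intro a ha
    rw [(hder a ha).deriv]
    have h := inverseMultiquadric_quadForm_pos hx hc ha hw
    have : ∑ i, ∑ j, c i * c j * (1 / (2 * Real.sqrt (a + w * ‖x i - x j‖ ^ 2))) =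
        (1 / 2) * ∑ i, ∑ j, c i * c j * (Real.sqrt (a + w * ‖x i - x j‖ ^ 2))⁻¹ := by
      simp_rw [Finset.mul_sum]
      refine Finset.sum_congr rfl fun i _ => Finset.sum_congr rfl fun j _ => ?_
      rw [one_div, mul_inv]
      ring
    rw [this]
    linarith
  have hmono : StrictMonoOn F (Set.Ioi 0) := by
    refine strictMonoOn_of_deriv_pos (convex_Ioi 0)
      (fun a ha => (hder a ha).continuousAt.continuousWithinAt) fun a ha => ?_
    rw [interior_Ioi] at ha
    exact hder_pos a ha
  have hlim : Tendsto F atTop (𝓝 0) := by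
    have hF' : F = fun a => ∑ i, ∑ j, c i * c j *
        (Real.sqrt (a + w * ‖x i - x j‖ ^ 2) - Real.sqrt a) := by
      funext a
      simp only [hF, mul_sub, Finset.sum_sub_distrib]
      have : ∑ i, ∑ j, c i * c j * Real.sqrt a = 0 := by
        simp_rw [mul_assoc, ← Finset.mul_sum, ← Finset.sum_mul, hsum]
        simp
      rw [this, sub_zero]
    rw [hF']
    have h0 : (0 : ℝ) = ∑ i : ι, ∑ j : ι, c i * c j * 0 := by simp
    rw [h0]
    exact tendsto_finsetSum _ fun i _ => tendsto_finsetSum _ fun j _ =>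
      (tendsto_sqrt_add_sub_sqrt (by positivity)).const_mul _
  have h12 : F 1 < F 2 := hmono (by simp) (by simp) (by norm_num)
  refine h12.trans_le (ge_of_tendsto hlim ?_)
  filter_upwards [eventually_ge_atTop 2] with a ha
  exact hmono.monotoneOn (by simp) (show (0 : ℝ) < a by linarith) ha

lemma det_ne_zero_of_quadForm_ne_zero [DecidableEq ι] (M : Matrix ι ι ℝ)
    (h : ∀ c : ι → ℝ, c ≠ 0 → ∑ i, ∑ j, c i * c j * M i j ≠ 0) : M.det ≠ 0 := by
  intro hdet
  obtain ⟨c, hc, hMc⟩ := Matrix.exists_mulVec_eq_zero_iff.2 hdet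
  refine h c hc (Finset.sum_eq_zero fun i _ => ?_)
  have := congrFun hMc i
  simp only [Matrix.mulVec, dotProduct, Pi.zero_apply] at this
  simp_rw [mul_assoc, ← Finset.mul_sum]
  rw [Finset.sum_congr rfl fun j _ => mul_comm (c j) (M i j), this, mul_zero]

/-- A symmetric matrix with positive diagonal whose quadratic form is negative on the nonzero
vectors of zero sum is nonsingular. -/
lemma det_ne_zero_of_quadForm_neg [DecidableEq ι] (M : Matrix ι ι ℝ) (hM : M.IsSymm)
    (hdiag : ∀ i, 0 < M i i)
    (h : ∀ c : ι → ℝ, c ≠ 0 → ∑ i, c i = 0 → M.toBilin' c c < 0) : M.det ≠ 0 := by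
  intro hdet
  obtain ⟨c, hc, hMc⟩ := Matrix.exists_mulVec_eq_zero_iff.2 hdet
  have hr : ∀ v, M.toBilin' v c = 0 := fun v => by
    rw [Matrix.toBilin'_apply', hMc, dotProduct_zero]
  have hl : ∀ v, M.toBilin' c v = 0 := fun v => by
    rw [Matrix.toBilin'_apply', Matrix.dotProduct_mulVec, ← Matrix.mulVec_transpose, hM.eq, hMc,
      zero_dotProduct]
  have hs : ∑ i, c i ≠ 0 := fun hs => (h c hc hs).ne (hr c)
  obtain ⟨k, -⟩ := Function.ne_iff.1 hc
  -- Subtracting a multiple of the kernel vector `c` gives sum zero without changing the form, which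
  -- stays at `M k k > 0`.
  set v : ι → ℝ := Pi.single k 1 - (∑ i, c i)⁻¹ • c with hv
  have hvv : M.toBilin' v v = M k k := by
    simp only [hv, map_sub, map_smul, LinearMap.sub_apply, LinearMap.smul_apply, hr, hl,
      Matrix.toBilin'_single]
    simp
  have hvs : ∑ i, v i = 0 := by
    simp [hv, Finset.sum_sub_distrib, ← Finset.mul_sum, hs]
  have hv0 : v ≠ 0 := by
    intro h0
    have := hdiag k
    rw [← hvv, h0] at this
    simp at this
  have := h v hv0 hvs
  rw [hvv] at this
  exact absurd this (hdiag k).le.not_gt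

/-- Interpolation matrices of multiquadrics and inverse multiquadrics are nonsingular. -/
lemma interpolation_det_ne_zero [DecidableEq ι] {x : ι → E} (hx : Function.Injective x) {ε : ℝ}
    (hε : 0 < ε) {φ : ℝ → ℝ} (hφ : φ = multiquadric ε ∨ φ = inverseMultiquadric ε) :
    (Matrix.of fun i j => φ ‖x i - x j‖).det ≠ 0 := by
  rcases hφ with rfl | rfl
  · refine det_ne_zero_of_quadForm_neg _ ?_ ?_ ?_
    · ext i j
      simp [norm_sub_rev (x i) (x j)]
    · intro i
      simp [multiquadric]
    · intro c hc hs
      have := multiquadric_quadForm_neg hx hc hs (pow_pos hε 2)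
      simpa [Matrix.toBilin'_apply, multiquadric, mul_pow, mul_right_comm] using this
  · refine det_ne_zero_of_quadForm_ne_zero _ fun c hc => ?_
    have := inverseMultiquadric_quadForm_pos hx hc one_pos (pow_pos hε 2)
    simpa [inverseMultiquadric, mul_pow] using this.ne'

end Interpolation

end Kansa

namespace Kansa

open Filter Topology

/-! ### Independence of square roots of quadratics, by complex continuation. -/

section SquareRoots

/-- The quadratic polynomial `κ + η (w - τ) ^ 2` with real coefficients, of a complex variable. -/
noncomputable def quadratic (κ η τ : ℝ) (w : ℂ) : ℂ := κ + η * (w - τ) ^ 2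

lemma analyticAt_quadratic (κ η τ : ℝ) (w : ℂ) : AnalyticAt ℂ (quadratic κ η τ) w := by
  unfold quadratic
  fun_prop

lemma quadratic_ofReal (κ η τ t : ℝ) :
    quadratic κ η τ t = ((κ + η * (t - τ) ^ 2 : ℝ) : ℂ) := by
  simp [quadratic]

lemma quadratic_ofReal_mem_slitPlane {κ η : ℝ} (hκ : 0 < κ) (hη : 0 < η) (τ t : ℝ) :
    quadratic κ η τ t ∈ Complex.slitPlane := by
  rw [quadratic_ofReal, Complex.ofReal_mem_slitPlane]
  positivity

/-- The real line together with the vertical segment from `τ` to the root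
`τ + i √(κ / η)` of the quadratic polynomial. -/
def lineWithSlit (κ η τ : ℝ) : Set ℂ :=
  Set.range (fun t : ℝ => (t : ℂ)) ∪
    (fun y : ℝ => (τ : ℂ) + y * Complex.I) '' Set.Icc 0 (Real.sqrt (κ / η))

lemma isConnected_lineWithSlit (κ η τ : ℝ) : IsConnected (lineWithSlit κ η τ) := by
  refine IsConnected.union ⟨(τ : ℂ), ⟨τ, rfl⟩, ⟨0, by simp, by simp⟩⟩ ?_ ?_
  · exact isConnected_range Complex.continuous_ofReal
  · exact (isConnected_Icc (Real.sqrt_nonneg _)).image _ (by fun_prop)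

lemma ofReal_mem_lineWithSlit (κ η τ t : ℝ) : (t : ℂ) ∈ lineWithSlit κ η τ := Or.inl ⟨t, rfl⟩

lemma root_mem_lineWithSlit (κ η τ : ℝ) :
    (τ : ℂ) + Real.sqrt (κ / η) * Complex.I ∈ lineWithSlit κ η τ :=
  Or.inr ⟨_, ⟨Real.sqrt_nonneg _, le_rfl⟩, rfl⟩

lemma quadratic_root {κ η : ℝ} (hκ : 0 < κ) (hη : 0 < η) (τ : ℝ) :
    quadratic κ η τ ((τ : ℂ) + Real.sqrt (κ / η) * Complex.I) = 0 := by
  have h : ((Real.sqrt (κ / η) : ℝ) : ℂ) ^ 2 = κ / η := by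
    rw [← Complex.ofReal_pow, Real.sq_sqrt (by positivity)]
    push_cast
    rfl
  have hη' : (η : ℂ) ≠ 0 := by exact_mod_cast hη.ne'
  rw [quadratic, add_sub_cancel_left, mul_pow, h, Complex.I_sq]
  field_simp
  ring

lemma deriv_quadratic_root_ne_zero {κ η : ℝ} (hκ : 0 < κ) (hη : 0 < η) (τ : ℝ) :
    deriv (quadratic κ η τ) ((τ : ℂ) + Real.sqrt (κ / η) * Complex.I) ≠ 0 := by
  have h : ∀ w, HasDerivAt (quadratic κ η τ) (η * (2 * (w - τ))) w := by
    intro w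
    have := ((((hasDerivAt_id w).sub_const (τ : ℂ)).pow 2).const_mul (η : ℂ)).const_add (κ : ℂ)
    refine (this.congr_deriv ?_)
    simp
  rw [(h _).deriv, add_sub_cancel_left]
  have h1 : (η : ℂ) ≠ 0 := by exact_mod_cast hη.ne'
  have h2 : ((Real.sqrt (κ / η) : ℝ) : ℂ) ≠ 0 := by
    exact_mod_cast (Real.sqrt_pos.2 (div_pos hκ hη)).ne'
  simp [h1, h2]

/-- Above the vertex `τ'`, the quadratic with vertex `τ` has imaginary part `2η(τ' - τ)y`, nonzero
for `y > 0`. So the path to one root avoids the branch cuts of all the other square roots. -/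
lemma quadratic_mem_slitPlane_of_mem {κ κ' η τ τ' : ℝ} (hκ : 0 < κ) (hη : 0 < η)
    (hτ : τ ≠ τ') {w : ℂ} (hw : w ∈ lineWithSlit κ' η τ') :
    quadratic κ η τ w ∈ Complex.slitPlane := by
  rcases hw with ⟨t, rfl⟩ | ⟨y, hy, rfl⟩
  · exact quadratic_ofReal_mem_slitPlane hκ hη τ t
  · rcases hy.1.eq_or_lt with rfl | hy0
    · simpa using quadratic_ofReal_mem_slitPlane hκ hη τ τ'
    · refine Or.inr ?_
      have : (quadratic κ η τ ((τ' : ℂ) + y * Complex.I)).im = η * (2 * (τ' - τ) * y) := by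
        simp [quadratic, sq]
        left
        ring
      rw [this]
      have := sub_ne_zero.2 hτ.symm
      positivity

lemma analyticOrderAt_ofReal_eq_top {f : ℂ → ℂ} (hf : AnalyticAt ℂ f 0)
    (h : ∀ t : ℝ, f t = 0) : analyticOrderAt f 0 = ⊤ := by
  rw [analyticOrderAt_eq_top, ← hf.frequently_zero_iff_eventually_zero]
  have ht : Tendsto (fun t : ℝ => (t : ℂ)) (𝓝[≠] 0) (𝓝[≠] 0) := by
    refine tendsto_nhdsWithin_of_tendsto_nhds_of_eventually_within _ ?_ ?_
    · exact (Complex.continuous_ofReal.tendsto' 0 0 (by simp)).mono_left nhdsWithin_le_nhds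
    · filter_upwards [self_mem_nhdsWithin] with t ht
      simpa using ht
  exact ht.frequently (Eventually.of_forall fun t => h t).frequently

lemma analyticOrderAt_eq_top_of_mem {U : Set ℂ} (hU : IsConnected U) {f : ℂ → ℂ}
    (hf : AnalyticOnNhd ℂ f U) {z z' : ℂ} (hz : z ∈ U) (hz' : z' ∈ U)
    (h : analyticOrderAt f z = ⊤) : analyticOrderAt f z' = ⊤ := by
  by_contra hne
  exact ((hf.exists_analyticOrderAt_ne_top_iff_forall hU).1 ⟨⟨z', hz'⟩, hne⟩) ⟨z, hz⟩ h

lemma eq_zero_of_mem_of_ofReal {U : Set ℂ} (hU : IsConnected U) (hR : ∀ t : ℝ, (t : ℂ) ∈ U)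
    {f : ℂ → ℂ} (hf : AnalyticOnNhd ℂ f U) (h : ∀ t : ℝ, f t = 0) {z : ℂ} (hz : z ∈ U) :
    f z = 0 := by
  have h0 : (0 : ℂ) ∈ U := by simpa using hR 0
  have := analyticOrderAt_eq_top_of_mem hU hf h0 hz (analyticOrderAt_ofReal_eq_top (hf 0 h0) h)
  exact (analyticOrderAt_eq_top.1 this).self_of_nhds

/-- If `G ^ 2 = q * H ^ 2` on the real line and `q` has a simple zero in a connected set containing
the real line on which everything is analytic, then `G` vanishes on the real line. -/
lemma eq_zero_of_sq_eq_mul_sq {U : Set ℂ} (hU : IsConnected U) (hR : ∀ t : ℝ, (t : ℂ) ∈ U)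
    {G H q : ℂ → ℂ} (hG : AnalyticOnNhd ℂ G U) (hH : AnalyticOnNhd ℂ H U)
    (hq : AnalyticOnNhd ℂ q U) (h : ∀ t : ℝ, G t ^ 2 = q t * H t ^ 2) {z : ℂ} (hz : z ∈ U)
    (hqz : q z = 0) (hq' : deriv q z ≠ 0) (t : ℝ) : G t = 0 := by
  have h0 : (0 : ℂ) ∈ U := by simpa using hR 0
  have hF : AnalyticOnNhd ℂ (fun w => G w ^ 2 - q w * H w ^ 2) U := fun w hw =>
    ((hG w hw).pow 2).fun_sub ((hq w hw).fun_mul ((hH w hw).pow 2))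
  have htop := analyticOrderAt_eq_top_of_mem hU hF h0 hz
    (analyticOrderAt_ofReal_eq_top (hF 0 h0) fun t => sub_eq_zero.2 (h t))
  rw [analyticOrderAt_eq_top] at htop
  have heq : (G ^ 2) =ᶠ[𝓝 z] (q * H ^ 2) := by
    filter_upwards [htop] with w hw
    exact sub_eq_zero.1 hw
  have hq1 : analyticOrderAt q z = 1 := by
    have := (hq z hz).analyticOrderAt_sub_eq_one_of_deriv_ne_zero hq'
    simpa [hqz] using this
  have hord := analyticOrderAt_congr heq
  rw [analyticOrderAt_pow (hG z hz), analyticOrderAt_mul (hq z hz) ((hH z hz).pow 2),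
    analyticOrderAt_pow (hH z hz), hq1] at hord
  -- Parity: if finite, the order of `G ^ 2` at `z` is even, whereas that of `q * H ^ 2` is odd or
  -- infinite.
  have hGtop : analyticOrderAt G z = ⊤ := by
    by_contra hne
    obtain ⟨a, ha⟩ := ENat.ne_top_iff_exists.1 hne
    rw [← ha] at hord
    by_cases hHt : analyticOrderAt H z = ⊤
    · rw [hHt] at hord
      simp at hord
      exact absurd hord (by exact_mod_cast ENat.natCast_ne_top (2 * a))
    · obtain ⟨b, hb⟩ := ENat.ne_top_iff_exists.1 hHt
      rw [← hb] at hord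
      simp only [nsmul_eq_mul] at hord
      have : 2 * a = 1 + 2 * b := by exact_mod_cast hord
      omega
  have := analyticOrderAt_eq_top_of_mem hU hG hz (hR t) hGtop
  exact (analyticOrderAt_eq_top.1 this).self_of_nhds

variable {ι : Type*} [Fintype ι] [DecidableEq ι]

/-- The function `√q * F(q) / q ^ M`, with the principal branch of the square root. -/
noncomputable def sqrtTerm (q : ℂ → ℂ) (F : ℂ → ℂ) (M : ℕ) (w : ℂ) : ℂ :=
  q w ^ (1 / 2 : ℂ) * F (q w) / q w ^ M

lemma cpow_half_mul_self (z : ℂ) : z ^ (1 / 2 : ℂ) * z ^ (1 / 2 : ℂ) = z := by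
  have := Complex.cpow_nat_inv_pow z two_ne_zero
  rw [sq] at this
  simpa using this

lemma sqrtTerm_mul_sqrtTerm (q F F' : ℂ → ℂ) (M : ℕ) (w : ℂ) :
    sqrtTerm q F M w * sqrtTerm q F' M w = q w * (F (q w) * F' (q w)) / q w ^ (2 * M) := by
  rw [sqrtTerm, sqrtTerm, div_mul_div_comm, mul_mul_mul_comm, cpow_half_mul_self, ← pow_add,
    two_mul]

lemma analyticAt_sqrtTerm {q F : ℂ → ℂ} {w : ℂ} (hq : AnalyticAt ℂ q w)
    (hF : ∀ z, AnalyticAt ℂ F z) (hw : q w ∈ Complex.slitPlane) (M : ℕ) :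
    AnalyticAt ℂ (sqrtTerm q F M) w :=
  ((hq.cpow analyticAt_const hw).fun_mul ((hF _).fun_comp hq)).fun_div (hq.pow M)
    (pow_ne_zero _ (Complex.slitPlane_ne_zero hw))

/-- The square root attached to one of the quadratic polynomials can only cancel against itself:
in a vanishing bilinear expression, the off-diagonal terms involving the index `k` can be
dropped. -/
lemma sum_sqrtTerm_drop {κ τ : ι → ℝ} {η : ℝ} (hκ : ∀ a, 0 < κ a) (hη : 0 < η)
    (hτ : Function.Injective τ) {R C : ι → ℂ → ℂ} (hR : ∀ a z, AnalyticAt ℂ (R a) z)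
    (hC : ∀ a z, AnalyticAt ℂ (C a) z) (M : ℕ) {B : ι → ι → ℂ} {c₀ : ℂ}
    (h : ∀ t : ℝ, ∑ a, ∑ b, B a b * sqrtTerm (quadratic (κ a) η (τ a)) (R a) M t *
      sqrtTerm (quadratic (κ b) η (τ b)) (C b) M t = c₀) (k : ι) (t : ℝ) :
    ∑ a, ∑ b, (if a ≠ b ∧ (a = k ∨ b = k) then 0 else B a b) *
      sqrtTerm (quadratic (κ a) η (τ a)) (R a) M t *
      sqrtTerm (quadratic (κ b) η (τ b)) (C b) M t = c₀ := by
  set q : ι → ℂ → ℂ := fun a => quadratic (κ a) η (τ a) with hq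
  have hqa : ∀ a w, AnalyticAt ℂ (q a) w := fun a w => analyticAt_quadratic _ _ _ _
  set U := lineWithSlit (κ k) η (τ k) with hU
  have hslit : ∀ a, a ≠ k → ∀ w ∈ U, q a w ∈ Complex.slitPlane := fun a ha w hw =>
    quadratic_mem_slitPlane_of_mem (hκ a) hη (hτ.ne ha) hw
  set S : ℂ → ℂ := fun w => ∑ a ∈ Finset.univ.erase k, ∑ b ∈ Finset.univ.erase k,
    B a b * sqrtTerm (q a) (R a) M w * sqrtTerm (q b) (C b) M w with hS
  set X : ℂ → ℂ := fun w => ∑ b ∈ Finset.univ.erase k, B k b * sqrtTerm (q b) (C b) M w with hX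
  set Y : ℂ → ℂ := fun w => ∑ a ∈ Finset.univ.erase k, B a k * sqrtTerm (q a) (R a) M w with hY
  have hr : ∀ a ∈ Finset.univ.erase k, ∀ w ∈ U, AnalyticAt ℂ (sqrtTerm (q a) (R a) M) w :=
    fun a ha w hw => analyticAt_sqrtTerm (hqa a w) (hR a) (hslit a (Finset.ne_of_mem_erase ha) w hw) M
  have hc : ∀ a ∈ Finset.univ.erase k, ∀ w ∈ U, AnalyticAt ℂ (sqrtTerm (q a) (C a) M) w :=
    fun a ha w hw => analyticAt_sqrtTerm (hqa a w) (hC a) (hslit a (Finset.ne_of_mem_erase ha) w hw) M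
  have hSan : AnalyticOnNhd ℂ S U := fun w hw =>
    Finset.analyticAt_fun_sum _ fun a ha => Finset.analyticAt_fun_sum _ fun b hb =>
      (analyticAt_const.fun_mul (hr a ha w hw)).fun_mul (hc b hb w hw)
  have hXan : AnalyticOnNhd ℂ X U := fun w hw =>
    Finset.analyticAt_fun_sum _ fun b hb => analyticAt_const.fun_mul (hc b hb w hw)
  have hYan : AnalyticOnNhd ℂ Y U := fun w hw =>
    Finset.analyticAt_fun_sum _ fun a ha => analyticAt_const.fun_mul (hr a ha w hw)
  -- After multiplication by `q k ^ (2 * M)`, which clears the poles at the root, `G` collects the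
  -- terms free of `√(q k)` and `√(q k) * H` those linear in it. The hypothesis reads `G = -√(q k) *
  -- H` on the real line; squaring removes the branch.
  set G : ℂ → ℂ := fun w => q k w ^ (2 * M) * (S w - c₀) +
    B k k * (q k w * (R k (q k w) * C k (q k w))) with hG
  set H : ℂ → ℂ := fun w => q k w ^ M * (R k (q k w) * X w + C k (q k w) * Y w) with hH
  have hRk : ∀ w, AnalyticAt ℂ (fun w => R k (q k w)) w := fun w => (hR k _).fun_comp (hqa k w)
  have hCk : ∀ w, AnalyticAt ℂ (fun w => C k (q k w)) w := fun w => (hC k _).fun_comp (hqa k w)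
  have hGan : AnalyticOnNhd ℂ G U := fun w hw =>
    (((hqa k w).fun_pow _).fun_mul ((hSan w hw).fun_sub analyticAt_const)).fun_add
      (analyticAt_const.fun_mul ((hqa k w).fun_mul ((hRk w).fun_mul (hCk w))))
  have hHan : AnalyticOnNhd ℂ H U := fun w hw =>
    ((hqa k w).fun_pow _).fun_mul
      (((hRk w).fun_mul (hXan w hw)).fun_add ((hCk w).fun_mul (hYan w hw)))
  have hne : ∀ t : ℝ, q k t ≠ 0 := fun t =>
    Complex.slitPlane_ne_zero (quadratic_ofReal_mem_slitPlane (hκ k) hη _ t)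
  have hsplit : ∀ (B' : ι → ι → ℂ) (w : ℂ),
      ∑ a, ∑ b, B' a b * sqrtTerm (q a) (R a) M w * sqrtTerm (q b) (C b) M w =
      (∑ a ∈ Finset.univ.erase k, ∑ b ∈ Finset.univ.erase k,
        B' a b * sqrtTerm (q a) (R a) M w * sqrtTerm (q b) (C b) M w) +
      B' k k * (sqrtTerm (q k) (R k) M w * sqrtTerm (q k) (C k) M w) +
      sqrtTerm (q k) (R k) M w *
        ∑ b ∈ Finset.univ.erase k, B' k b * sqrtTerm (q b) (C b) M w +
      sqrtTerm (q k) (C k) M w *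
        ∑ a ∈ Finset.univ.erase k, B' a k * sqrtTerm (q a) (R a) M w := by
    intro B' w
    have h1 : ∀ f : ι → ℂ, ∑ a, f a = f k + ∑ a ∈ Finset.univ.erase k, f a := fun f =>
      (Finset.add_sum_erase _ f (Finset.mem_univ k)).symm
    simp only [h1, Finset.sum_add_distrib, Finset.mul_sum]
    have e1 : ∀ b, sqrtTerm (q k) (R k) M w * (B' k b * sqrtTerm (q b) (C b) M w) =
        B' k b * sqrtTerm (q k) (R k) M w * sqrtTerm (q b) (C b) M w := fun b => by ring
    have e2 : ∀ a, sqrtTerm (q k) (C k) M w * (B' a k * sqrtTerm (q a) (R a) M w) =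
        B' a k * sqrtTerm (q a) (R a) M w * sqrtTerm (q k) (C k) M w := fun b => by ring
    simp only [e1, e2]
    ring
  have hdiag : ∀ t : ℝ, q k t ^ (2 * M) *
      (sqrtTerm (q k) (R k) M t * sqrtTerm (q k) (C k) M t) =
      q k t * (R k (q k t) * C k (q k t)) := fun t => by
    rw [sqrtTerm_mul_sqrtTerm, mul_div_cancel₀ _ (pow_ne_zero _ (hne t))]
  have hGH : ∀ t : ℝ, G t = -(q k t ^ (1 / 2 : ℂ) * H t) := by
    intro t
    have h1 := h t
    rw [hsplit] at h1
    have h2 : G t = q k t ^ (2 * M) * (S t - c₀ +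
        B k k * (sqrtTerm (q k) (R k) M t * sqrtTerm (q k) (C k) M t)) := by
      rw [mul_add, mul_left_comm _ (B k k), hdiag]
    have h3 : S t - c₀ + B k k * (sqrtTerm (q k) (R k) M t * sqrtTerm (q k) (C k) M t) =
        -(sqrtTerm (q k) (R k) M t * X t + sqrtTerm (q k) (C k) M t * Y t) := by
      linear_combination h1
    rw [h2, h3, sqrtTerm, sqrtTerm, hH, two_mul, pow_add]
    have := pow_ne_zero M (hne t)
    field_simp
  have hsq : ∀ t : ℝ, G t ^ 2 = q k t * H t ^ 2 := by
    intro t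
    rw [hGH, neg_sq, mul_pow, sq (q k t ^ (1 / 2 : ℂ)), cpow_half_mul_self]
  have hG0 := eq_zero_of_sq_eq_mul_sq (isConnected_lineWithSlit _ _ _)
    (ofReal_mem_lineWithSlit _ _ _) hGan hHan (fun w _ => hqa k w) hsq
    (root_mem_lineWithSlit _ _ _) (quadratic_root (hκ k) hη _)
    (deriv_quadratic_root_ne_zero (hκ k) hη _) t
  rw [hsplit]
  have e1 : ∀ b ∈ Finset.univ.erase k, (if k ≠ b ∧ (k = k ∨ b = k) then 0 else B k b) = 0 :=
    fun b hb => by simp [(Finset.ne_of_mem_erase hb).symm]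
  have e2 : ∀ a ∈ Finset.univ.erase k, (if a ≠ k ∧ (a = k ∨ k = k) then 0 else B a k) = 0 :=
    fun b hb => by simp [Finset.ne_of_mem_erase hb]
  have e3 : ∀ a ∈ Finset.univ.erase k, ∀ b ∈ Finset.univ.erase k,
      (if a ≠ b ∧ (a = k ∨ b = k) then 0 else B a b) = B a b := fun a ha b hb => by
    simp [Finset.ne_of_mem_erase ha, Finset.ne_of_mem_erase hb]
  rw [Finset.sum_congr rfl fun a ha => Finset.sum_congr rfl fun b hb => by rw [e3 a ha b hb],
    Finset.sum_congr rfl fun b hb => congrArg (· * sqrtTerm (q b) (C b) M t) (e1 b hb),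
    Finset.sum_congr rfl fun a ha => congrArg (· * sqrtTerm (q a) (R a) M t) (e2 a ha)]
  simp only [ne_eq, not_true_eq_false, false_and, if_false, zero_mul, Finset.sum_const_zero,
    mul_zero, add_zero]
  have h2 : q k t ^ (2 * M) * (S t - c₀ +
      B k k * (sqrtTerm (q k) (R k) M t * sqrtTerm (q k) (C k) M t)) = 0 := by
    rw [mul_add, mul_left_comm _ (B k k), hdiag]
    exact hG0
  have h3 := (mul_eq_zero.1 h2).resolve_left (pow_ne_zero _ (hne t))
  linear_combination h3

/-- Each use of `sum_sqrtTerm_drop` yields an identity of the same shape with fewer off-diagonal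
terms, so the indices can be treated one after another. -/
lemma sum_sqrtTerm_diagonal {κ τ : ι → ℝ} {η : ℝ} (hκ : ∀ a, 0 < κ a) (hη : 0 < η)
    (hτ : Function.Injective τ) {R C : ι → ℂ → ℂ} (hR : ∀ a z, AnalyticAt ℂ (R a) z)
    (hC : ∀ a z, AnalyticAt ℂ (C a) z) (M : ℕ) {B : ι → ι → ℂ} {c₀ : ℂ}
    (h : ∀ t : ℝ, ∑ a, ∑ b, B a b * sqrtTerm (quadratic (κ a) η (τ a)) (R a) M t *
      sqrtTerm (quadratic (κ b) η (τ b)) (C b) M t = c₀) (t : ℝ) :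
    ∑ a, B a a * (sqrtTerm (quadratic (κ a) η (τ a)) (R a) M t *
      sqrtTerm (quadratic (κ a) η (τ a)) (C a) M t) = c₀ := by
  have key : ∀ T : Finset ι, ∀ t : ℝ,
      ∑ a, ∑ b, (if a ≠ b ∧ (a ∈ T ∨ b ∈ T) then 0 else B a b) *
        sqrtTerm (quadratic (κ a) η (τ a)) (R a) M t *
        sqrtTerm (quadratic (κ b) η (τ b)) (C b) M t = c₀ := by
    intro T
    induction T using Finset.induction_on with
    | empty => simpa using h
    | insert k T _ ih =>
      intro t
      rw [← sum_sqrtTerm_drop hκ hη hτ hR hC M ih k t]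
      refine Finset.sum_congr rfl fun a _ => Finset.sum_congr rfl fun b _ => ?_
      congr 2
      simp only [Finset.mem_insert]
      split_ifs <;> tauto
  rw [← key Finset.univ t]
  refine Finset.sum_congr rfl fun a _ => ?_
  simp only [Finset.mem_univ, or_self, and_true, ne_eq, ite_not, ite_mul, zero_mul,
    Finset.sum_ite_eq, if_true]
  ring

/-- A bilinear expression in square roots of distinct quadratic polynomials, with poles on the
diagonal terms, is constant only if that constant is zero. -/
lemma eq_zero_of_sum_sqrtTerm_eq {κ τ : ι → ℝ} {η : ℝ} (hκ : ∀ a, 0 < κ a) (hη : 0 < η)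
    (hτ : Function.Injective τ) {R C N : ι → ℂ → ℂ} (hR : ∀ a z, AnalyticAt ℂ (R a) z)
    (hC : ∀ a z, AnalyticAt ℂ (C a) z) (hN : ∀ a z, AnalyticAt ℂ (N a) z) {M : ℕ}
    {j l : ι → ℕ} (hRC : ∀ a z, R a z * C a z = z ^ j a * N a z) (hN0 : ∀ a, N a 0 ≠ 0)
    (hl : ∀ a, l a ≠ 0) (hjl : ∀ a, j a + 1 + l a = 2 * M) {B : ι → ι → ℂ} {c₀ : ℂ}
    (h : ∀ t : ℝ, ∑ a, ∑ b, B a b * sqrtTerm (quadratic (κ a) η (τ a)) (R a) M t *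
      sqrtTerm (quadratic (κ b) η (τ b)) (C b) M t = c₀) : c₀ = 0 := by
  have hd := sum_sqrtTerm_diagonal hκ hη hτ hR hC M h
  set q : ι → ℂ → ℂ := fun a => quadratic (κ a) η (τ a) with hq
  have hqa : ∀ a w, AnalyticAt ℂ (q a) w := fun a w => analyticAt_quadratic _ _ _ _
  have hne : ∀ a (t : ℝ), q a t ≠ 0 := fun a t =>
    Complex.slitPlane_ne_zero (quadratic_ofReal_mem_slitPlane (hκ a) hη _ t)
  have hprod : ∀ a (t : ℝ), sqrtTerm (q a) (R a) M t * sqrtTerm (q a) (C a) M t =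
      N a (q a t) / q a t ^ l a := by
    intro a t
    rw [sqrtTerm_mul_sqrtTerm, hRC, ← hjl a, pow_add, pow_succ]
    have := hne a t
    field_simp
  have hd' : ∀ t : ℝ, ∑ a, B a a * (N a (q a t) / q a t ^ l a) = c₀ := fun t => by
    rw [← hd t]
    exact Finset.sum_congr rfl fun a _ => by rw [hprod]
  have hBk : ∀ k, B k k = 0 := by
    intro k
    set U := lineWithSlit (κ k) η (τ k) with hU
    -- Multiplication by `q k ^ l k` clears the pole at the root of `q k`; evaluated there, the
    -- continued identity leaves only `B k k * N k 0`.
    set f : ℂ → ℂ := fun w => B k k * N k (q k w) + q k w ^ l k *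
      ((∑ a ∈ Finset.univ.erase k, B a a * (N a (q a w) / q a w ^ l a)) - c₀) with hf
    have hfan : AnalyticOnNhd ℂ f U := by
      intro w hw
      refine (analyticAt_const.fun_mul ((hN k _).fun_comp (hqa k w))).fun_add
        (((hqa k w).fun_pow _).fun_mul (AnalyticAt.fun_sub ?_ analyticAt_const))
      refine Finset.analyticAt_fun_sum _ fun a ha => analyticAt_const.fun_mul
        (((hN a _).fun_comp (hqa a w)).fun_div ((hqa a w).fun_pow _) (pow_ne_zero _ ?_))
      exact Complex.slitPlane_ne_zero (quadratic_mem_slitPlane_of_mem (hκ a) hη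
        (hτ.ne (Finset.ne_of_mem_erase ha)) hw)
    have hf0 : ∀ t : ℝ, f t = 0 := by
      intro t
      have h1 := hd' t
      rw [← Finset.add_sum_erase _ _ (Finset.mem_univ k)] at h1
      have h2 := pow_ne_zero (l k) (hne k t)
      have h3 : f t = q k t ^ l k * (B k k * (N k (q k t) / q k t ^ l k) +
          (∑ a ∈ Finset.univ.erase k, B a a * (N a (q a t) / q a t ^ l a)) - c₀) := by
        simp only [hf]
        field_simp
        ring
      rw [h3, h1, sub_self, mul_zero]
    have := eq_zero_of_mem_of_ofReal (isConnected_lineWithSlit _ _ _)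
      (ofReal_mem_lineWithSlit _ _ _) hfan hf0 (root_mem_lineWithSlit (κ k) η (τ k))
    simp only [hf, hq, quadratic_root (hκ k) hη, zero_pow (hl k), zero_mul, add_zero] at this
    exact (mul_eq_zero.1 this).resolve_right (hN0 k)
  rw [← hd' 0]
  exact Finset.sum_eq_zero fun a _ => by rw [hBk, zero_mul]

end SquareRoots

end Kansa

namespace Kansa

open Filter Topology

/-! ### The Laplacians of the basis functions in terms of `radialQuad`. -/

section LaplacianFormula

variable {d : ℕ}

/-- The quantity `1 + ε² ‖x - a‖²`. -/
noncomputable def radialQuad (ε : ℝ) (x a : EuclideanSpace ℝ (Fin d)) : ℝ :=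
  1 + ε ^ 2 * ‖x - a‖ ^ 2

lemma radialQuad_pos (ε : ℝ) (x a : EuclideanSpace ℝ (Fin d)) : 0 < radialQuad ε x a := by
  unfold radialQuad
  positivity

lemma radialQuad_comm (ε : ℝ) (x a : EuclideanSpace ℝ (Fin d)) :
    radialQuad ε x a = radialQuad ε a x := by
  rw [radialQuad, radialQuad, norm_sub_rev]

@[simp]
lemma radialQuad_self (ε : ℝ) (x : EuclideanSpace ℝ (Fin d)) : radialQuad ε x x = 1 := by
  simp [radialQuad]

lemma hasFDerivAt_radialQuad_rpow (ε p : ℝ) (a x : EuclideanSpace ℝ (Fin d)) :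
    HasFDerivAt (fun y => radialQuad ε y a ^ p)
      ((2 * ε ^ 2 * p * radialQuad ε x a ^ (p - 1)) • innerSL ℝ (x - a)) x := by
  have h1 : HasFDerivAt (fun y => radialQuad ε y a) (ε ^ 2 • (2 • innerSL ℝ (x - a))) x := by
    have := ((((hasFDerivAt_id x).sub_const a).norm_sq).const_mul (ε ^ 2)).const_add 1
    refine this.congr_fderiv ?_
    ext v
    simp
  refine (h1.rpow_const (p := p) (Or.inl (radialQuad_pos ε x a).ne')).congr_fderiv ?_
  ext v
  simp
  ring

lemma laplacian_radialQuad_rpow (ε p : ℝ) (a x : EuclideanSpace ℝ (Fin d)) :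
    Laplacian.laplacian (fun y => radialQuad ε y a ^ p) x =
      2 * ε ^ 2 * p * radialQuad ε x a ^ (p - 1) * d +
      4 * ε ^ 4 * p * (p - 1) * radialQuad ε x a ^ (p - 2) * ‖x - a‖ ^ 2 := by
  rw [InnerProductSpace.laplacian_eq_iteratedFDeriv_orthonormalBasis _
    (EuclideanSpace.basisFun (Fin d) ℝ)]
  have hf : fderiv ℝ (fun y => radialQuad ε y a ^ p) = fun x =>
      (2 * ε ^ 2 * p * radialQuad ε x a ^ (p - 1)) • innerSL ℝ (x - a) :=
    funext fun y => (hasFDerivAt_radialQuad_rpow ε p a y).fderiv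
  -- `innerSL` is typed as conjugate-linear in its first argument; over the reals `J` is the same
  -- map typed as linear, as a derivative must be.
  obtain ⟨J, hJ⟩ : ∃ J : EuclideanSpace ℝ (Fin d) →L[ℝ] EuclideanSpace ℝ (Fin d) →L[ℝ] ℝ,
      ∀ v, J v = innerSL ℝ v := ⟨innerSL ℝ, fun _ => rfl⟩
  have hinner : HasFDerivAt (fun y : EuclideanSpace ℝ (Fin d) => innerSL ℝ (y - a)) J x := by
    simp only [← hJ]
    exact J.hasFDerivAt.comp x ((hasFDerivAt_id x).sub_const a)
  have h2 := ((hasFDerivAt_radialQuad_rpow ε (p - 1) a x).const_mul (2 * ε ^ 2 * p)).fun_smul hinner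
  simp only [iteratedFDeriv_two_apply, hf]
  rw [h2.fderiv]
  have hd : (d : ℝ) = ∑ i : Fin d, (1 : ℝ) := by simp
  rw [← (EuclideanSpace.basisFun (Fin d) ℝ).sum_sq_inner_left (x - a), hd, Finset.mul_sum,
    Finset.mul_sum, ← Finset.sum_add_distrib]
  refine Finset.sum_congr rfl fun i _ => ?_
  have hb : inner ℝ (EuclideanSpace.basisFun (Fin d) ℝ i) (EuclideanSpace.basisFun (Fin d) ℝ i)
      = (1 : ℝ) := by
    rw [real_inner_self_eq_norm_sq, (EuclideanSpace.basisFun (Fin d) ℝ).norm_eq_one, one_pow]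
  simp only [Matrix.cons_val_zero, Matrix.cons_val_one, add_apply, smul_apply, hJ,
    ContinuousLinearMap.smulRight_apply, innerSL_apply_apply, hb,
    smul_eq_mul]
  rw [show p - 1 - 1 = p - 2 by ring]
  ring

/-- A function of the quadratic quantity `q`, written as `√q * F(q) / q ^ 3`. -/
noncomputable def sqrtProfile (F : ℝ → ℝ) (q : ℝ) : ℝ := Real.sqrt q * F q / q ^ 3

/-- The polynomial `(α q + β) q ^ (1 - e)` occurring in the Laplacian of the basis functions. -/
def laplacianPoly (α β : ℝ) (e : ℕ) (q : ℝ) : ℝ := (α * q + β) * q ^ (1 - e)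

lemma rpow_add_half {q : ℝ} (hq : 0 < q) (k : ℤ) :
    q ^ ((k : ℝ) + 1 / 2) = q ^ k * Real.sqrt q := by
  rw [Real.rpow_add hq, Real.rpow_intCast, Real.sqrt_eq_rpow]

/-- Puts both kernels into one form: `e = 0` for the multiquadric, `e = 1` for the inverse one. The
sum `α + β` is the Laplacian at the center, where `q = 1`; `β ≠ 0` prevents the numerator `α q + β`
from cancelling the pole at `q = 0`. -/
lemma exists_sqrtProfile (hd : 1 ≤ d) {ε : ℝ} (hε : 0 < ε) {φ : ℝ → ℝ}
    (hφ : φ = multiquadric ε ∨ φ = inverseMultiquadric ε) :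
    ∃ (α β : ℝ) (e : ℕ), e ≤ 1 ∧ β ≠ 0 ∧ α + β ≠ 0 ∧
      ∀ x a : EuclideanSpace ℝ (Fin d),
        basisFun φ a x = sqrtProfile (fun q => q ^ (3 - e)) (radialQuad ε x a) ∧
        Laplacian.laplacian (basisFun φ a) x =
          sqrtProfile (laplacianPoly α β e) (radialQuad ε x a) := by
  have hd' : (d : ℝ) ≠ 0 := by positivity
  rcases hφ with rfl | rfl
  · have hfun : ∀ a : EuclideanSpace ℝ (Fin d), basisFun (multiquadric ε) a =
        fun y => radialQuad ε y a ^ (1 / 2 : ℝ) := by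
      intro a
      funext y
      rw [basisFun, multiquadric, radialQuad, mul_pow, Real.sqrt_eq_rpow]
    refine ⟨ε ^ 2 * (d - 1), ε ^ 2, 0, by norm_num, by positivity, ?_, fun x a => ⟨?_, ?_⟩⟩
    · rw [show ε ^ 2 * ((d : ℝ) - 1) + ε ^ 2 = ε ^ 2 * d by ring]
      positivity
    · have hq := radialQuad_pos ε x a
      rw [hfun, sqrtProfile, Real.sqrt_eq_rpow]
      field_simp
    · have hq := radialQuad_pos ε x a
      have h1 := rpow_add_half hq (-1)
      have h2 := rpow_add_half hq (-2)
      have hn : ε ^ 2 * ‖x - a‖ ^ 2 = radialQuad ε x a - 1 := by simp [radialQuad]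
      rw [hfun, laplacian_radialQuad_rpow, show (1 / 2 - 1 : ℝ) = ((-1 : ℤ) : ℝ) + 1 / 2 by norm_num,
        show (1 / 2 - 2 : ℝ) = ((-2 : ℤ) : ℝ) + 1 / 2 by norm_num, h1, h2, sqrtProfile,
        laplacianPoly]
      generalize radialQuad ε x a = q at *
      have : 4 * ε ^ 4 * (1 / 2 : ℝ) * (((-1 : ℤ) : ℝ) + 1 / 2) * (q ^ (-2 : ℤ) * Real.sqrt q) *
          ‖x - a‖ ^ 2 = - ε ^ 2 * (q ^ (-2 : ℤ) * Real.sqrt q) * (q - 1) := by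
        rw [← hn]
        push_cast
        ring
      rw [this, zpow_neg, zpow_neg]
      simp only [zpow_ofNat]
      field_simp
      ring
  · have hfun : ∀ a : EuclideanSpace ℝ (Fin d), basisFun (inverseMultiquadric ε) a =
        fun y => radialQuad ε y a ^ (-1 / 2 : ℝ) := by
      intro a
      funext y
      rw [basisFun, inverseMultiquadric, mul_pow, Real.sqrt_eq_rpow, neg_div,
        Real.rpow_neg (radialQuad_pos ε y a).le, radialQuad, one_div]
    refine ⟨ε ^ 2 * (3 - d), -3 * ε ^ 2, 1, by norm_num, ?_, ?_, fun x a => ⟨?_, ?_⟩⟩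
    · have := hε.ne'
      simp [this]
    · rw [show ε ^ 2 * (3 - (d : ℝ)) + -3 * ε ^ 2 = -(ε ^ 2 * d) by ring]
      exact neg_ne_zero.2 (by positivity)
    · have hq := radialQuad_pos ε x a
      have h1 := rpow_add_half hq (-1)
      simp only [hfun]
      rw [show (-1 / 2 : ℝ) = ((-1 : ℤ) : ℝ) + 1 / 2 by norm_num, h1, sqrtProfile,
        zpow_neg, zpow_one]
      field_simp
    · have hq := radialQuad_pos ε x a
      have h1 := rpow_add_half hq (-2)
      have h2 := rpow_add_half hq (-3)
      have hn : ε ^ 2 * ‖x - a‖ ^ 2 = radialQuad ε x a - 1 := by simp [radialQuad]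
      rw [hfun, laplacian_radialQuad_rpow, show (-1 / 2 - 1 : ℝ) = ((-2 : ℤ) : ℝ) + 1 / 2 by norm_num,
        show (-1 / 2 - 2 : ℝ) = ((-3 : ℤ) : ℝ) + 1 / 2 by norm_num, h1, h2, sqrtProfile,
        laplacianPoly]
      generalize radialQuad ε x a = q at *
      have : 4 * ε ^ 4 * (-1 / 2 : ℝ) * (((-2 : ℤ) : ℝ) + 1 / 2) * (q ^ (-3 : ℤ) * Real.sqrt q) *
          ‖x - a‖ ^ 2 = 3 * ε ^ 2 * (q ^ (-3 : ℤ) * Real.sqrt q) * (q - 1) := by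
        rw [← hn]
        push_cast
        ring
      rw [this, zpow_neg, zpow_neg]
      simp only [zpow_ofNat]
      field_simp
      ring

end LaplacianFormula

end Kansa

namespace Kansa

open Filter Topology
open scoped ContDiff

/-! ### Zero sets of real-analytic functions are null. -/

section NullSets

variable {E : Type*} [NormedAddCommGroup E] [NormedSpace ℝ E] [FiniteDimensional ℝ E]
  [MeasurableSpace E] [BorelSpace E]

/-- A measurable set whose intersections with the lines through a given point are null is itself
null. -/
lemma addHaar_eq_zero_of_lines (μ : Measure E) [μ.IsAddHaarMeasure] {Z : Set E}
    (hZ : MeasurableSet Z) (x₁ : E) (h : ∀ y : E, volume {t : ℝ | x₁ + t • y ∈ Z} = 0) :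
    μ Z = 0 := by
  have hmeas : MeasurableSet {p : E × ℝ | x₁ + p.2 • p.1 ∈ Z} :=
    (show Continuous fun p : E × ℝ => x₁ + p.2 • p.1 by fun_prop).measurable hZ
  have h1 : (μ.prod volume) {p : E × ℝ | x₁ + p.2 • p.1 ∈ Z} = 0 :=
    (Measure.measure_prod_null hmeas).2 (Eventually.of_forall fun y => h y)
  have h2 : ((volume : Measure ℝ).prod μ) {p : ℝ × E | x₁ + p.1 • p.2 ∈ Z} = 0 := by
    rw [← (Measure.measurePreserving_swap (μ := (volume : Measure ℝ)) (ν := μ)).measure_preimage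
      hmeas.nullMeasurableSet] at h1
    exact h1
  have h3 := Measure.measure_ae_null_of_prod_null h2
  have h4 : ∀ᵐ t : ℝ, t ≠ 0 := by simp [ae_iff, measure_singleton]
  -- A single scale `t ≠ 0` with null slice is enough: that slice is the preimage of `Z` under a
  -- homothety and a translation.
  obtain ⟨t, ht, ht0⟩ := (h3.and h4).exists
  replace ht : μ ((fun y => t • y) ⁻¹' ((fun y => x₁ + y) ⁻¹' Z)) = 0 := ht
  rw [Measure.addHaar_preimage_smul μ ht0, measure_preimage_add] at ht
  refine (mul_eq_zero.1 ht).resolve_left ?_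
  rw [ENNReal.ofReal_eq_zero, not_le]
  positivity

lemma volume_zero_set_eq_zero_of_analytic {g : ℝ → ℝ} (hg : ContDiff ℝ ω g) {t₀ : ℝ}
    (h : g t₀ ≠ 0) : volume {t | g t = 0} = 0 := by
  have han : AnalyticOnNhd ℝ g Set.univ := contDiff_omega_iff_analyticOnNhd.1 hg
  rcases han.eqOn_zero_or_eventually_ne_zero_of_preconnected isPreconnected_univ with h0 | h0
  · exact absurd (h0 (Set.mem_univ t₀)) h
  · have := ae_restrict_le_codiscreteWithin (μ := (volume : Measure ℝ)) MeasurableSet.univ h0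
    simpa [mem_ae_iff, Set.compl_def] using this

/-- The zero set of a nonzero real-analytic function is null. -/
lemma addHaar_zero_set_eq_zero_of_analytic (μ : Measure E) [μ.IsAddHaarMeasure] {f : E → ℝ}
    (hf : ContDiff ℝ ω f) {x₁ : E} (h : f x₁ ≠ 0) : μ {x | f x = 0} = 0 := by
  refine addHaar_eq_zero_of_lines μ (hf.continuous.measurable (measurableSet_singleton 0)) x₁
    fun y => ?_
  exact volume_zero_set_eq_zero_of_analytic (g := fun t => f (x₁ + t • y)) (t₀ := 0)
    (hf.comp (by fun_prop)) (by simpa using h)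

end NullSets

/-! ### Restriction to a line in a generic direction. -/

section GenericLine

variable {d : ℕ} {ι : Type*} [Finite ι]

lemma exists_separating_direction (hd : 1 ≤ d) {A : ι → EuclideanSpace ℝ (Fin d)}
    (hA : Function.Injective A) : ∃ v : EuclideanSpace ℝ (Fin d), v ≠ 0 ∧
      Function.Injective fun a => inner ℝ (A a) v := by
  have : Nonempty (Fin d) := ⟨⟨0, hd⟩⟩
  obtain ⟨w₀, hw₀⟩ := exists_ne (0 : EuclideanSpace ℝ (Fin d))
  -- The index `none` carries an arbitrary nonzero vector, which forces `v ≠ 0` even when there are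
  -- no pairs to separate.
  set w : Option {p : ι × ι // p.1 ≠ p.2} → EuclideanSpace ℝ (Fin d) := fun o =>
    o.elim w₀ fun p => A p.1.1 - A p.1.2 with hw
  obtain ⟨v, hv⟩ := Module.Dual.exists_forall_ne_zero_of_forall_exists
    (fun o => innerₗ (EuclideanSpace ℝ (Fin d)) (w o)) (by
      intro o
      have hne : w o ≠ 0 := by
        rcases o with _ | ⟨p, hp⟩
        · exact hw₀
        · exact sub_ne_zero.2 (hA.ne hp)
      exact ⟨w o, by simpa using hne⟩)
  refine ⟨v, ?_, ?_⟩
  · rintro rfl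
    simpa using hv none
  · intro a b hab
    by_contra hne
    refine hv (some ⟨(a, b), hne⟩) ?_
    simp only [hw, Option.elim, innerₗ_apply_apply, inner_sub_left]
    exact sub_eq_zero.2 hab

/-- Completing the square: the leading coefficient does not depend on the center, and the vertex is
governed by `inner ℝ a v`, which is why the direction must separate the centers. -/
lemma radialQuad_smul_eq (ε t : ℝ) {v : EuclideanSpace ℝ (Fin d)} (hv : v ≠ 0)
    (a : EuclideanSpace ℝ (Fin d)) :
    radialQuad ε (t • v) a =
      (1 + ε ^ 2 * (‖a‖ ^ 2 - inner ℝ a v ^ 2 / ‖v‖ ^ 2)) +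
        ε ^ 2 * ‖v‖ ^ 2 * (t - inner ℝ a v / ‖v‖ ^ 2) ^ 2 := by
  have : ‖v‖ ≠ 0 := norm_ne_zero_iff.2 hv
  rw [radialQuad, norm_sub_sq_real, norm_smul, real_inner_smul_left, real_inner_comm,
    mul_pow, Real.norm_eq_abs, sq_abs]
  field_simp
  ring

lemma one_add_mul_sub_pos (ε : ℝ) {v : EuclideanSpace ℝ (Fin d)} (hv : v ≠ 0)
    (a : EuclideanSpace ℝ (Fin d)) :
    0 < 1 + ε ^ 2 * (‖a‖ ^ 2 - inner ℝ a v ^ 2 / ‖v‖ ^ 2) := by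
  have h0 : 0 < ‖v‖ ^ 2 := by positivity
  have h1 : inner ℝ a v ^ 2 / ‖v‖ ^ 2 ≤ ‖a‖ ^ 2 := by
    rw [div_le_iff₀ h0, ← mul_pow, sq_le_sq, abs_of_nonneg (by positivity : 0 ≤ ‖a‖ * ‖v‖)]
    exact abs_real_inner_le_norm a v
  have : 0 ≤ ε ^ 2 * (‖a‖ ^ 2 - inner ℝ a v ^ 2 / ‖v‖ ^ 2) :=
    mul_nonneg (sq_nonneg _) (sub_nonneg.2 h1)
  linarith

lemma ofReal_sqrtProfile {F : ℝ → ℝ} {F' : ℂ → ℂ} (hF : ∀ x : ℝ, F' x = F x) {κ η : ℝ}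
    (hκ : 0 < κ) (hη : 0 < η) (τ t : ℝ) :
    ((sqrtProfile F (κ + η * (t - τ) ^ 2) : ℝ) : ℂ) = sqrtTerm (quadratic κ η τ) F' 3 t := by
  have hpos : 0 ≤ κ + η * (t - τ) ^ 2 := by positivity
  rw [sqrtTerm, quadratic_ofReal, hF, sqrtProfile, Real.sqrt_eq_rpow]
  rw [Complex.ofReal_div, Complex.ofReal_mul, Complex.ofReal_cpow hpos]
  simp

/-- The bilinear expression in the Laplacians and the values of the basis functions that expresses
the determinant of the bordered matrix is not constant, unless that constant is zero. -/
lemma eq_zero_of_sum_sqrtProfile_eq (hd : 1 ≤ d) {ε : ℝ} (hε : 0 < ε) {ι₁ ι₂ : Type*}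
    [Fintype ι₁] [Fintype ι₂] {A : ι₁ ⊕ ι₂ → EuclideanSpace ℝ (Fin d)}
    (hA : Function.Injective A) {α β : ℝ} {e : ℕ} (he : e ≤ 1) (hβ : β ≠ 0)
    {B : ι₁ ⊕ ι₂ → ι₁ ⊕ ι₂ → ℝ} {c₀ : ℝ}
    (h : ∀ x, ∑ a, ∑ b, B a b * sqrtProfile (laplacianPoly α β e) (radialQuad ε x (A a)) *
      sqrtProfile (Sum.elim (fun _ => laplacianPoly α β e) (fun _ q => q ^ (3 - e)) b)
        (radialQuad ε x (A b)) = c₀) : c₀ = 0 := by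
  classical
  obtain ⟨v, hv, hinj⟩ := exists_separating_direction hd hA
  have hv0 : 0 < ‖v‖ ^ 2 := by positivity
  set κ : ι₁ ⊕ ι₂ → ℝ := fun a => 1 + ε ^ 2 * (‖A a‖ ^ 2 - inner ℝ (A a) v ^ 2 / ‖v‖ ^ 2) with hκd
  set τ : ι₁ ⊕ ι₂ → ℝ := fun a => inner ℝ (A a) v / ‖v‖ ^ 2 with hτd
  have hκ : ∀ a, 0 < κ a := fun a => one_add_mul_sub_pos ε hv _
  have hη : 0 < ε ^ 2 * ‖v‖ ^ 2 := by positivity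
  have hτ : Function.Injective τ := fun a b hab => hinj ((div_left_inj' hv0.ne').1 hab)
  set L : ℂ → ℂ := fun q => (α * q + β) * q ^ (1 - e) with hL
  set C : ι₁ ⊕ ι₂ → ℂ → ℂ := Sum.elim (fun _ => L) (fun _ q => q ^ (3 - e)) with hC
  set N : ι₁ ⊕ ι₂ → ℂ → ℂ := Sum.elim (fun _ q => (α * q + β) ^ 2) (fun _ q => α * q + β) with hN
  have hLan : ∀ z, AnalyticAt ℂ L z := fun z => by fun_prop
  have hβ' : (β : ℂ) ≠ 0 := by exact_mod_cast hβ
  -- The diagonal terms are `q ^ (j + 1) * N / q ^ 6`, so `l = 5 - j`: interior indices pair two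
  -- Laplacians, boundary indices a Laplacian with a value.
  have key := eq_zero_of_sum_sqrtTerm_eq hκ hη hτ (R := fun _ => L) (C := C) (N := N) (M := 3)
    (j := Sum.elim (fun _ => 2 * (1 - e)) (fun _ => (1 - e) + (3 - e)))
    (l := Sum.elim (fun _ => 3 + 2 * e) (fun _ => 1 + 2 * e))
    (B := fun a b => (B a b : ℂ)) (c₀ := (c₀ : ℂ)) (fun _ => hLan) ?_ ?_ ?_ ?_ ?_ ?_ ?_
  · exact_mod_cast key
  · rintro (a | a) z
    · exact hLan z
    · simp only [hC, Sum.elim_inr]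
      fun_prop
  · rintro (a | a) z <;> simp only [hN, Sum.elim_inr, Sum.elim_inl] <;> fun_prop
  · rintro (a | a) z
    · simp only [hC, hN, hL, Sum.elim_inl]
      ring
    · simp only [hC, hN, hL, Sum.elim_inr]
      ring
  · rintro (a | a) <;> simp [hN, hβ']
  · rintro (a | a) <;> simp
  · rintro (a | a) <;> simp only [Sum.elim_inr, Sum.elim_inl] <;> omega
  · intro t
    rw [← h (t • v)]
    push_cast
    refine Finset.sum_congr rfl fun a _ => Finset.sum_congr rfl fun b _ => ?_
    rw [radialQuad_smul_eq ε t hv, radialQuad_smul_eq ε t hv,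
      ofReal_sqrtProfile (F' := L) (fun x => by simp [hL, laplacianPoly]) (hκ a) hη (τ a) t,
      ofReal_sqrtProfile (F' := C b) (fun x => by
        rcases b with b | b <;> simp [hC, hL, laplacianPoly]) (hκ b) hη (τ b) t]

end GenericLine

end Kansa

namespace Kansa

open Filter Topology
open scoped ContDiff

/-! ### The Kansa determinant: bordering and induction on the interior points. -/

section Collocation

variable {d n m : ℕ}

lemma kansaMatrix_eq {ε α β : ℝ} {e : ℕ} {φ : ℝ → ℝ}
    (hφ : ∀ x a : EuclideanSpace ℝ (Fin d),
      basisFun φ a x = sqrtProfile (fun q => q ^ (3 - e)) (radialQuad ε x a) ∧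
      Laplacian.laplacian (basisFun φ a) x =
        sqrtProfile (laplacianPoly α β e) (radialQuad ε x a))
    (P : Fin n → EuclideanSpace ℝ (Fin d)) (Q : Fin m → EuclideanSpace ℝ (Fin d)) :
    kansaMatrix φ P Q = Matrix.of fun a b =>
      sqrtProfile (Sum.elim (fun _ => laplacianPoly α β e) (fun _ q => q ^ (3 - e)) a)
        (radialQuad ε (Sum.elim P Q a) (Sum.elim P Q b)) := by
  ext (a | a) (b | b) <;> simp [kansaMatrix, (hφ _ _).1, (hφ _ _).2]

/-- Coinciding points give equal columns. Thus the induction hypothesis already contains the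
distinctness of the centers, including interior from boundary ones. -/
lemma injective_of_kansaMatrix_det_ne_zero {φ : ℝ → ℝ}
    {P : Fin n → EuclideanSpace ℝ (Fin d)} {Q : Fin m → EuclideanSpace ℝ (Fin d)}
    (h : (kansaMatrix φ P Q).det ≠ 0) : Function.Injective (Sum.elim P Q) := by
  intro a b hab
  by_contra hne
  refine h (Matrix.det_zero_of_column_eq hne fun k => ?_)
  rcases k with k | k <;> rcases a with a | a <;> rcases b with b | b <;>
    simp only [Sum.elim_inl, Sum.elim_inr] at hab <;> simp [kansaMatrix, hab]

lemma contDiff_sqrtProfile_comp {V : Type*} [NormedAddCommGroup V] [NormedSpace ℝ V]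
    {F : ℝ → ℝ} (hF : ContDiff ℝ ω F) (ε : ℝ) {f g : V → EuclideanSpace ℝ (Fin d)}
    (hf : ContDiff ℝ ω f) (hg : ContDiff ℝ ω g) :
    ContDiff ℝ ω fun x => sqrtProfile F (radialQuad ε (f x) (g x)) := by
  have hq : ContDiff ℝ ω fun x => radialQuad ε (f x) (g x) :=
    contDiff_const.add (contDiff_const.mul ((hf.sub hg).norm_sq ℝ))
  have hne : ∀ x, radialQuad ε (f x) (g x) ≠ 0 := fun x => (radialQuad_pos ε _ _).ne'
  exact ((hq.sqrt hne).mul (hF.comp hq)).div (hq.pow 3) fun x => pow_ne_zero 3 (hne x)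

lemma contDiff_kansaMatrix_det {ε α β : ℝ} {e : ℕ} {φ : ℝ → ℝ}
    (hφ : ∀ x a : EuclideanSpace ℝ (Fin d),
      basisFun φ a x = sqrtProfile (fun q => q ^ (3 - e)) (radialQuad ε x a) ∧
      Laplacian.laplacian (basisFun φ a) x =
        sqrtProfile (laplacianPoly α β e) (radialQuad ε x a))
    (Q : Fin m → EuclideanSpace ℝ (Fin d)) :
    ContDiff ℝ ω fun P : Fin n → EuclideanSpace ℝ (Fin d) => (kansaMatrix φ P Q).det := by
  simp only [kansaMatrix_eq hφ, Matrix.det_apply]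
  have hA : ∀ a : Fin n ⊕ Fin m, ContDiff ℝ ω
      fun P : Fin n → EuclideanSpace ℝ (Fin d) => Sum.elim P Q a := by
    rintro (a | a)
    · exact contDiff_apply ℝ _ a
    · exact contDiff_const
  have hF : ∀ a : Fin n ⊕ Fin m, ContDiff ℝ ω
      (Sum.elim (fun _ => laplacianPoly α β e) (fun _ q => q ^ (3 - e)) a : ℝ → ℝ) := by
    rintro (a | a)
    · simp only [Sum.elim_inl]
      unfold laplacianPoly
      fun_prop
    · simp only [Sum.elim_inr]
      fun_prop
  refine ContDiff.sum fun s _ => ContDiff.const_smul _ (contDiff_prod fun a _ => ?_)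
  exact contDiff_sqrtProfile_comp (hF _) ε (hA _) (hA _)

/-- The bordered determinant obtained by adding an interior point. -/
lemma kansaMatrix_cons_det {ε α β : ℝ} {e : ℕ} {φ : ℝ → ℝ}
    (hφ : ∀ x a : EuclideanSpace ℝ (Fin d),
      basisFun φ a x = sqrtProfile (fun q => q ^ (3 - e)) (radialQuad ε x a) ∧
      Laplacian.laplacian (basisFun φ a) x =
        sqrtProfile (laplacianPoly α β e) (radialQuad ε x a))
    (P : Fin n → EuclideanSpace ℝ (Fin d)) (Q : Fin m → EuclideanSpace ℝ (Fin d))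
    (h : (kansaMatrix φ P Q).det ≠ 0) (x : EuclideanSpace ℝ (Fin d)) :
    (kansaMatrix φ (Fin.cons x P : Fin (n + 1) → EuclideanSpace ℝ (Fin d)) Q).det =
      (kansaMatrix φ P Q).det * ((α + β) - ∑ a, ∑ b, (kansaMatrix φ P Q)⁻¹ a b *
        sqrtProfile (laplacianPoly α β e) (radialQuad ε x (Sum.elim P Q a)) *
        sqrtProfile (Sum.elim (fun _ => laplacianPoly α β e) (fun _ q => q ^ (3 - e)) b)
          (radialQuad ε x (Sum.elim P Q b))) := by
  set K := kansaMatrix φ P Q with hK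
  set E : Unit ⊕ (Fin n ⊕ Fin m) ≃ Fin (n + 1) ⊕ Fin m :=
    (Equiv.sumAssoc Unit (Fin n) (Fin m)).symm.trans
      (Equiv.sumCongr ((Equiv.sumComm _ _).trans
        ((Equiv.optionEquivSumPUnit (Fin n)).symm.trans (finSuccEquiv n).symm)) (Equiv.refl _))
    with hE
  have hE0 : ∀ u, E (Sum.inl u) = Sum.inl 0 := fun u => rfl
  have hE1 : ∀ i, E (Sum.inr (Sum.inl i)) = Sum.inl i.succ := fun i => by simp [hE]
  have hE2 : ∀ i, E (Sum.inr (Sum.inr i)) = Sum.inr i := fun i => rfl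
  have hblock : (kansaMatrix φ (Fin.cons x P : Fin (n + 1) → _) Q).submatrix E E =
      Matrix.fromBlocks (Matrix.of fun _ _ => α + β)
        (Matrix.of fun _ a =>
          sqrtProfile (laplacianPoly α β e) (radialQuad ε x (Sum.elim P Q a)))
        (Matrix.of fun b _ =>
          sqrtProfile (Sum.elim (fun _ => laplacianPoly α β e) (fun _ q => q ^ (3 - e)) b)
            (radialQuad ε x (Sum.elim P Q b))) K := by
    rw [hK, kansaMatrix_eq hφ, kansaMatrix_eq hφ]
    ext (a | a | a) (b | b | b) <;>
      simp [hE0, hE1, hE2, radialQuad_comm ε _ x, sqrtProfile, laplacianPoly]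
  have : Invertible K := Matrix.invertibleOfIsUnitDet K (isUnit_iff_ne_zero.2 h)
  -- Schur complement with respect to the old block `K`; the corner is `α + β` because `radialQuad ε
  -- x x = 1`.
  rw [← Matrix.det_submatrix_equiv_self E, hblock, Matrix.det_fromBlocks₂₂,
    Matrix.invOf_eq_nonsing_inv, Matrix.det_unique (n := Unit), Matrix.sub_apply, Matrix.mul_assoc]
  congr 2
  simp only [Matrix.mul_apply, Matrix.of_apply, Finset.mul_sum]
  refine Finset.sum_congr rfl fun a _ => Finset.sum_congr rfl fun b _ => ?_
  ring

/-- Were the determinant zero for every `x`, the bordered formula would give a bilinear expression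
constantly equal to `α + β ≠ 0`, against `eq_zero_of_sum_sqrtProfile_eq`; analyticity then makes the
zero set null. -/
lemma volume_kansaMatrix_cons_det_eq_zero (hd : 1 ≤ d) {ε : ℝ} (hε : 0 < ε) {φ : ℝ → ℝ}
    (hφ : φ = multiquadric ε ∨ φ = inverseMultiquadric ε)
    {P : Fin n → EuclideanSpace ℝ (Fin d)} {Q : Fin m → EuclideanSpace ℝ (Fin d)}
    (h : (kansaMatrix φ P Q).det ≠ 0) :
    volume {x | (kansaMatrix φ (Fin.cons x P : Fin (n + 1) → EuclideanSpace ℝ (Fin d)) Q).det = 0}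
      = 0 := by
  obtain ⟨α, β, e, he, hβ, hαβ, hform⟩ := exists_sqrtProfile hd hε hφ
  obtain ⟨x, hx⟩ : ∃ x, (kansaMatrix φ (Fin.cons x P : Fin (n + 1) → _) Q).det ≠ 0 := by
    by_contra! hall
    refine hαβ (eq_zero_of_sum_sqrtProfile_eq (α := α) hd hε (injective_of_kansaMatrix_det_ne_zero h) he hβ
      (B := fun a b => (kansaMatrix φ P Q)⁻¹ a b) fun x => ?_)
    have := hall x
    rw [kansaMatrix_cons_det hform P Q h] at this
    exact (sub_eq_zero.1 ((mul_eq_zero.1 this).resolve_left h)).symm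
  refine addHaar_zero_set_eq_zero_of_analytic volume
    (f := fun x => (kansaMatrix φ (Fin.cons x P : Fin (n + 1) → _) Q).det)
    ((contDiff_kansaMatrix_det hform Q).comp (contDiff_pi.2 fun i => ?_)) hx
  refine Fin.cases ?_ (fun i => ?_) i
  · exact contDiff_id
  · simpa using contDiff_const

lemma kansaMatrix_zero_det_ne_zero {ε : ℝ} (hε : 0 < ε) {φ : ℝ → ℝ}
    (hφ : φ = multiquadric ε ∨ φ = inverseMultiquadric ε)
    (P : Fin 0 → EuclideanSpace ℝ (Fin d)) {Q : Fin m → EuclideanSpace ℝ (Fin d)}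
    (hQ : Function.Injective Q) : (kansaMatrix φ P Q).det ≠ 0 := by
  have hinj : Function.Injective (Sum.elim P Q) := by
    rintro (a | a) (b | b) hab
    · exact a.elim0
    · exact a.elim0
    · exact b.elim0
    · rw [hQ hab]
  convert interpolation_det_ne_zero hinj hε hφ
  ext (a | a) (b | b)
  · exact a.elim0
  · exact a.elim0
  · exact b.elim0
  · rfl

lemma ae_pi_kansaMatrix_det_ne_zero (hd : 1 ≤ d) {ε : ℝ} (hε : 0 < ε) {φ : ℝ → ℝ}
    (hφ : φ = multiquadric ε ∨ φ = inverseMultiquadric ε)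
    {Q : Fin m → EuclideanSpace ℝ (Fin d)} (hQ : Function.Injective Q)
    (ν : Measure (EuclideanSpace ℝ (Fin d))) [SigmaFinite ν] (hν : ν ≪ volume) (n : ℕ) :
    ∀ᵐ P ∂(Measure.pi fun _ : Fin n => ν), (kansaMatrix φ P Q).det ≠ 0 := by
  induction n with
  | zero => exact Eventually.of_forall fun P => kansaMatrix_zero_det_ne_zero hε hφ P hQ
  | succ n ih =>
    obtain ⟨α, β, e, -, -, -, hform⟩ := exists_sqrtProfile hd hε hφ
    have hmeas : MeasurableSet {P : Fin (n + 1) → EuclideanSpace ℝ (Fin d) |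
        (kansaMatrix φ P Q).det = 0} :=
      (contDiff_kansaMatrix_det hform Q).continuous.measurable (measurableSet_singleton 0)
    -- Coordinate 0 is split off as the new point; the swap lets Fubini fix the old points first and
    -- measure the slice in the new one.
    have hpres := (measurePreserving_piFinSuccAbove (fun _ : Fin (n + 1) => ν) 0).symm
    have hpres' := hpres.comp (Measure.measurePreserving_swap
      (μ := Measure.pi fun _ : Fin n => ν) (ν := ν))
    simp only [ae_iff, not_not]
    rw [← hpres'.measure_preimage hmeas.nullMeasurableSet]
    refine (Measure.measure_prod_null (hpres'.measurable hmeas)).2 ?_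
    filter_upwards [ih] with P hP
    refine measure_mono_null (fun x hx => ?_)
      (hν (volume_kansaMatrix_cons_det_eq_zero hd hε hφ hP))
    simpa [MeasurableEquiv.piFinSuccAbove, Fin.insertNthEquiv] using hx

end Collocation

end Kansa

/-! ### Transfer from the product measure to independent random points. -/

theorem theorem1 {d : ℕ} {D : Set (EuclideanSpace ℝ (Fin d))}
    (hD_open : IsOpen D) (hD_conn : IsConnected D) (hD_bdd : Bornology.IsBounded D)
    {ε : ℝ} (hε : 0 < ε) {φ : ℝ → ℝ}
    (hφ : φ = Kansa.multiquadric ε ∨ φ = Kansa.inverseMultiquadric ε)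
    {m : ℕ} (hm : 1 ≤ m) (Q : Fin m → EuclideanSpace ℝ (Fin d))
    (hQ_mem : ∀ h, Q h ∈ frontier D) (hQ_inj : Function.Injective Q)
    {σ : EuclideanSpace ℝ (Fin d) → ℝ} (hσ : Kansa.IsProbDensityOn σ D)
    {S : Type*} [MeasurableSpace S] (μ : Measure S) [IsProbabilityMeasure μ]
    (n : ℕ) (P : Fin n → S → EuclideanSpace ℝ (Fin d))
    (hP_law : ∀ i, HasLaw (P i) (Kansa.densityMeasure σ D) μ)
    (hP_indep : iIndepFun P μ) :
    ∀ᵐ ω ∂μ, (Kansa.kansaMatrix φ (fun i => P i ω) Q).det ≠ 0 := by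
  -- In dimension 0 a nonempty `D` is the whole space and has empty frontier, which leaves no place
  -- for `Q`.
  have hd : 1 ≤ d := by
    by_contra hd
    obtain rfl : d = 0 := by omega
    have hD : D = Set.univ := Subsingleton.eq_univ_of_nonempty hD_conn.nonempty
    have := hQ_mem ⟨0, hm⟩
    rw [hD, frontier_univ] at this
    exact this
  have hfin : IsFiniteMeasure (Kansa.densityMeasure σ D) :=
    isFiniteMeasure_withDensity_ofReal hσ.integrableOn.2
  have hac : Kansa.densityMeasure σ D ≪ volume :=
    (withDensity_absolutelyContinuous _ _).trans Measure.restrict_le_self.absolutelyContinuous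
  have hae := Kansa.ae_pi_kansaMatrix_det_ne_zero hd hε hφ hQ_inj
    (Kansa.densityMeasure σ D) hac n
  have hmeas : ∀ i, AEMeasurable (P i) μ := fun i => (hP_law i).aemeasurable
  have hmap := (iIndepFun_iff_map_fun_eq_pi_map hmeas).1 hP_indep
  simp only [(hP_law _).map_eq] at hmap
  rw [← hmap] at hae
  exact ae_of_ae_map (aemeasurable_pi_lambda _ hmeas) hae
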